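/- Let $p$ be a natural number, let $X, X', Y, Y'$ be random vectors in $\mathbb{R}^p$ defined on a common probability space, such that $X$ and $X'$ are independent and identically distributed, $Y$ and $Y'$ are independent and identically distributed, and $Y$ is independent of $X$. Let $\|\cdot\|$ be the Euclidean norm and let $0<\alpha\le 2$ be such that $E\|X\|^\alpha<\infty$ and $E\|Y\|^\alpha<\infty$. Then the three expectations in $$\mathcal{E}_\alpha(X,Y) = 2E\|X-Y\|^\alpha - E\|X-X'\|^\alpha - E\|Y-Y'\|^\alpha$$ are finite, and the following statements hold: (i) $\mathcal{E}_\alpha(X,Y)\ge 0$. (ii) If $0<\alpha<2$, then $\mathcal{E}_\alpha(X,Y)=0$ if and only if $X$ and $Y$ have the same distribution. (iii) If $\alpha=2$, then $X$ and $Y$ are integrable, and $\mathcal{E}_\alpha(X,Y)=0$ if and only if $E[X]=E[Y]$. -/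

import Mathlib

open MeasureTheory ProbabilityTheory

/-- The energy distance `2 E‖X - Y‖^α - E‖X - X'‖^α - E‖Y - Y'‖^α`, where `X'` and `Y'` are meant
to be independent copies of `X` and `Y`, and `‖·‖` is the Euclidean norm of `ℝ^p`. -/
noncomputable def energyDistance {Ω : Type*} [MeasurableSpace Ω] {p : ℕ} (P : Measure Ω) (α : ℝ)
    (X X' Y Y' : Ω → EuclideanSpace ℝ (Fin p)) : ℝ :=
  2 * (∫ ω, ‖X ω - Y ω‖ ^ α ∂P) - (∫ ω, ‖X ω - X' ω‖ ^ α ∂P) - (∫ ω, ‖Y ω - Y' ω‖ ^ α ∂P)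

/-! ### Gaussian kernels and characteristic functions -/

section GaussianDiscrepancy

open Complex ComplexConjugate

variable {E : Type*} [NormedAddCommGroup E] [InnerProductSpace ℝ E] [FiniteDimensional ℝ E]
  [MeasurableSpace E] [BorelSpace E]

/-! For `0 < α < 2`, `‖x - y‖ ^ α` is a positive multiple of the integral over `s > 0` of `1 - exp
(-s * ‖x - y‖ ^ 2)` against `s ^ (-1 - α / 2)`. The energy has coefficients `2, -1, -1`, so the
constants cancel and it becomes a positive mixture of Gaussian discrepancies
(`lawEnergy_eq_integral_gaussianDiscrepancy`). By the Fourier transform of the Gaussian, each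
discrepancy is a Gaussian-weighted squared L² distance between characteristic functions
(`gaussianDiscrepancy_eq_integral`): it is nonnegative, and zero only for equal laws.

For `α = 2` the mixture is not available; expanding the square leaves twice the squared distance of
the means (`lawEnergy_two`). -/

omit [BorelSpace E] in
lemma charFun_mul_conj_charFun (μ ν : Measure E) [IsProbabilityMeasure μ]
    [IsProbabilityMeasure ν] (v : E) :
    charFun μ v * conj (charFun ν v) =
      ∫ z, cexp (I * (inner ℝ (z.1 - z.2) v : ℝ)) ∂(μ.prod ν) := by
  rw [← charFun_neg, charFun_apply, charFun_apply, ← integral_prod_mul]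
  congr 1 with z
  rw [← Complex.exp_add, inner_sub_left, inner_neg_right]
  push_cast
  ring_nf

lemma integrable_gaussian_mul_charFun (μ ν : Measure E) [IsProbabilityMeasure μ]
    [IsProbabilityMeasure ν] {b : ℝ} (hb : 0 < b) :
    Integrable (fun v : E ↦ (cexp (-b * ‖v‖ ^ 2)) * (charFun μ v * conj (charFun ν v))) := by
  have h := GaussianFourier.integrable_cexp_neg_mul_sq_norm_add (V := E) (b := b) (by simpa using hb) 0 0
  simp only [zero_mul, add_zero] at h
  refine h.mul_bdd (c := 1) (by fun_prop) (.of_forall fun v ↦ ?_)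
  rw [norm_mul, RCLike.norm_conj]
  exact mul_le_one₀ (norm_charFun_le_one _) (norm_nonneg _) (norm_charFun_le_one _)

lemma integral_gaussian_mul_charFun (μ ν : Measure E) [IsProbabilityMeasure μ]
    [IsProbabilityMeasure ν] {b : ℝ} (hb : 0 < b) :
    ∫ v : E, cexp (-b * ‖v‖ ^ 2) * (charFun μ v * conj (charFun ν v)) =
      (((Real.pi / b) ^ (Module.finrank ℝ E / 2 : ℝ) *
        ∫ z, Real.exp (-(4 * b)⁻¹ * ‖z.1 - z.2‖ ^ 2) ∂(μ.prod ν) : ℝ) : ℂ) := by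
  have hb' : 0 < (b : ℂ).re := by simpa using hb
  simp_rw [charFun_mul_conj_charFun, ← MeasureTheory.integral_const_mul]
  rw [integral_integral_swap]
  · rw [← integral_complex_ofReal]
    congr 1 with z
    simp_rw [← Complex.exp_add]
    rw [GaussianFourier.integral_cexp_neg_mul_sq_norm_add hb']
    push_cast
    rw [Complex.ofReal_cpow (by positivity)]
    push_cast
    congr 2
    rw [Complex.I_sq]
    field_simp
  -- Fubini applies because the phase has modulus one and the Gaussian in `v` is integrable.
  · have h := (GaussianFourier.integrable_cexp_neg_mul_sq_norm_add (V := E) hb' 0 0).mul_prod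
      (integrable_const (μ := μ.prod ν) (1 : ℂ))
    simp only [zero_mul, add_zero, mul_one] at h
    refine (h.mul_bdd (g := fun q ↦ cexp (I * (inner ℝ (q.2.1 - q.2.2) q.1 : ℝ))) (c := 1)
      (by fun_prop) (.of_forall fun q ↦ ?_)).congr (.of_forall fun q ↦ ?_)
    · rw [mul_comm, Complex.norm_exp_ofReal_mul_I]
    · simp [Function.uncurry]

/-- The energy `2 E k(X, Y) - E k(X, X') - E k(Y, Y')` of the negated Gaussian kernel
`k(x, y) = -exp (-s * ‖x - y‖ ^ 2)`, for `X, X'` with law `μ` and `Y, Y'` with law `ν`. -/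
noncomputable def gaussianDiscrepancy (s : ℝ) (μ ν : Measure E) : ℝ :=
  (∫ z, Real.exp (-s * ‖z.1 - z.2‖ ^ 2) ∂(μ.prod μ)) +
    (∫ z, Real.exp (-s * ‖z.1 - z.2‖ ^ 2) ∂(ν.prod ν)) -
    2 * ∫ z, Real.exp (-s * ‖z.1 - z.2‖ ^ 2) ∂(μ.prod ν)

lemma normSq_sub_eq_re (a b : ℂ) :
    normSq (a - b) = (a * conj a).re + (b * conj b).re - 2 * (a * conj b).re := by
  simp [normSq_apply]; ring

/-- Expand `normSq (a - b)` and apply the Gaussian Fourier identity to each of the three products.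
-/
lemma gaussianDiscrepancy_eq_integral (μ ν : Measure E) [IsProbabilityMeasure μ]
    [IsProbabilityMeasure ν] {b : ℝ} (hb : 0 < b) :
    Integrable (fun v : E ↦ Real.exp (-b * ‖v‖ ^ 2) * normSq (charFun μ v - charFun ν v)) ∧
    (Real.pi / b) ^ (Module.finrank ℝ E / 2 : ℝ) * gaussianDiscrepancy (4 * b)⁻¹ μ ν =
      ∫ v : E, Real.exp (-b * ‖v‖ ^ 2) * normSq (charFun μ v - charFun ν v) := by
  have key (μ ν : Measure E) [IsProbabilityMeasure μ] [IsProbabilityMeasure ν] :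
      Integrable (fun v : E ↦ Real.exp (-b * ‖v‖ ^ 2) * (charFun μ v * conj (charFun ν v)).re) ∧
      (Real.pi / b) ^ (Module.finrank ℝ E / 2 : ℝ) *
        (∫ z, Real.exp (-(4 * b)⁻¹ * ‖z.1 - z.2‖ ^ 2) ∂(μ.prod ν)) =
        ∫ v : E, Real.exp (-b * ‖v‖ ^ 2) * (charFun μ v * conj (charFun ν v)).re := by
    have e : (fun v : E ↦ Real.exp (-b * ‖v‖ ^ 2) * (charFun μ v * conj (charFun ν v)).re) =
        fun v ↦ RCLike.re (cexp (-b * ‖v‖ ^ 2) * (charFun μ v * conj (charFun ν v))) := by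
      ext v
      rw [show (-b * ‖v‖ ^ 2 : ℂ) = ((-b * ‖v‖ ^ 2 : ℝ) : ℂ) by push_cast; rfl, ← ofReal_exp]
      exact (re_ofReal_mul _ _).symm
    have hi := integrable_gaussian_mul_charFun μ ν hb
    rw [e]
    refine ⟨hi.re, ?_⟩
    rw [integral_re hi, integral_gaussian_mul_charFun μ ν hb]
    exact (ofReal_re _).symm
  obtain ⟨h1, e1⟩ := key μ μ
  obtain ⟨h2, e2⟩ := key ν ν
  obtain ⟨h3, e3⟩ := key μ ν
  have e : (fun v : E ↦ Real.exp (-b * ‖v‖ ^ 2) * normSq (charFun μ v - charFun ν v)) =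
      fun v ↦ Real.exp (-b * ‖v‖ ^ 2) * (charFun μ v * conj (charFun μ v)).re +
        Real.exp (-b * ‖v‖ ^ 2) * (charFun ν v * conj (charFun ν v)).re -
        2 * (Real.exp (-b * ‖v‖ ^ 2) * (charFun μ v * conj (charFun ν v)).re) := by
    ext v
    rw [normSq_sub_eq_re]
    ring
  rw [e]
  refine ⟨(h1.add h2).sub (h3.const_mul 2), ?_⟩
  rw [integral_sub (by exact h1.add h2) (h3.const_mul 2), integral_add h1 h2,
    MeasureTheory.integral_const_mul, ← e1,
    ← e2, ← e3, gaussianDiscrepancy]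
  ring

lemma gaussianDiscrepancy_nonneg (μ ν : Measure E) [IsProbabilityMeasure μ]
    [IsProbabilityMeasure ν] {s : ℝ} (hs : 0 < s) : 0 ≤ gaussianDiscrepancy s μ ν := by
  -- The choice of `b` inverts `s = (4 * b)⁻¹`.
  have h := (gaussianDiscrepancy_eq_integral μ ν (b := (4 * s)⁻¹) (by positivity)).2
  rw [show (4 * (4 * s)⁻¹)⁻¹ = s by field_simp] at h
  refine nonneg_of_mul_nonneg_right (h ▸ integral_nonneg fun v ↦ ?_) (by positivity)
  exact mul_nonneg (Real.exp_nonneg _) (normSq_nonneg _)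

lemma eq_of_gaussianDiscrepancy_eq_zero {μ ν : Measure E} [IsProbabilityMeasure μ]
    [IsProbabilityMeasure ν] {s : ℝ} (hs : 0 < s) (h0 : gaussianDiscrepancy s μ ν = 0) :
    μ = ν := by
  obtain ⟨hi, h⟩ := gaussianDiscrepancy_eq_integral μ ν (b := (4 * s)⁻¹) (by positivity)
  rw [show (4 * (4 * s)⁻¹)⁻¹ = s by field_simp, h0, mul_zero, eq_comm,
    integral_eq_zero_iff_of_nonneg
      (fun v ↦ mul_nonneg (Real.exp_nonneg _) (normSq_nonneg _)) hi] at h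
  have h' : charFun μ =ᵐ[volume] charFun ν := by
    filter_upwards [h] with v hv
    simpa [Real.exp_ne_zero, sub_eq_zero] using hv
  -- Lebesgue measure charges open sets, so continuity upgrades a.e. equality to equality.
  exact Measure.ext_of_charFun ((continuous_charFun.ae_eq_iff_eq volume continuous_charFun).1 h')

end GaussianDiscrepancy

/-! ### Powers as mixtures of exponentials -/

section PowerMixture

open Set Real

/-- The constant `C` in `C * r ^ β = ∫ s in (0, ∞), (1 - exp (-s * r)) * s ^ (-1 - β)`. -/
noncomputable def powMixtureConst (β : ℝ) : ℝ :=
  ∫ s in Ioi (0 : ℝ), (1 - exp (-s)) * s ^ (-1 - β)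

variable {β : ℝ}

/-- Near `0` the bound `1 - exp (-s) ≤ s` leaves `s ^ (-β)`, integrable since `β < 1`; beyond `1`
the tail `s ^ (-1 - β)` is integrable since `β > 0`. -/
lemma integrableOn_one_sub_exp_mul_rpow (h0 : 0 < β) (h1 : β < 1) :
    IntegrableOn (fun s : ℝ ↦ (1 - exp (-s)) * s ^ (-1 - β)) (Ioi 0) := by
  rw [← Ioc_union_Ioi_eq_Ioi zero_le_one]
  refine IntegrableOn.union ?_ ?_
  · have h : IntegrableOn (fun s : ℝ ↦ s ^ (-β)) (Ioc 0 1) := by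
      rw [← intervalIntegrable_iff_integrableOn_Ioc_of_le zero_le_one]
      exact intervalIntegral.intervalIntegrable_rpow' (by linarith)
    refine h.mono' (by fun_prop) (ae_restrict_of_forall_mem measurableSet_Ioc fun s hs ↦ ?_)
    have hs0 : 0 < s := hs.1
    rw [norm_mul, norm_of_nonneg (by simpa using hs0.le), norm_of_nonneg (by positivity)]
    calc (1 - exp (-s)) * s ^ (-1 - β) ≤ s * s ^ (-1 - β) := by
          gcongr
          linarith [one_sub_le_exp_neg s]
      _ = s ^ (-β) := by
          nth_rw 1 [← rpow_one s]
          rw [← rpow_add hs0]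
          ring_nf
  · refine (integrableOn_Ioi_rpow_of_lt (a := -1 - β) (by linarith) one_pos).mono'
      (by fun_prop) (ae_restrict_of_forall_mem measurableSet_Ioi fun s hs ↦ ?_)
    have hs0 : 0 < s := one_pos.trans hs
    rw [norm_mul, norm_of_nonneg (by simpa using hs0.le), norm_of_nonneg (by positivity)]
    exact mul_le_of_le_one_left (by positivity) (by linarith [exp_pos (-s)])

lemma powMixtureConst_pos (h0 : 0 < β) (h1 : β < 1) : 0 < powMixtureConst β := by
  have hpos : ∀ s ∈ Ioi (0 : ℝ), 0 < (1 - exp (-s)) * s ^ (-1 - β) := fun s hs ↦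
    mul_pos (by simpa using hs) (rpow_pos_of_pos hs _)
  rw [powMixtureConst, setIntegral_pos_iff_support_of_nonneg_ae
    (ae_restrict_of_forall_mem measurableSet_Ioi fun s hs ↦ (hpos s hs).le)
    (integrableOn_one_sub_exp_mul_rpow h0 h1)]
  rw [inter_eq_self_of_subset_right fun s hs ↦ Function.mem_support.2 (hpos s hs).ne']
  simp

/-- Prepares the substitution `s ↦ r * s`, whose Jacobian turns `r ^ (1 + β)` into `r ^ β`. -/
lemma one_sub_exp_mul_rpow_comp_mul {r s : ℝ} (hr : 0 < r) (hs : 0 < s) :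
    (1 - exp (-s * r)) * s ^ (-1 - β) =
      r ^ (1 + β) * ((1 - exp (-(r * s))) * (r * s) ^ (-1 - β)) := by
  rw [mul_rpow hr.le hs.le, show (-1 - β) = -(1 + β) by ring, rpow_neg hr.le,
    show -s * r = -(r * s) by ring]
  have := (rpow_pos_of_pos hr (1 + β)).ne'
  field_simp

lemma integrableOn_one_sub_exp_mul_mul_rpow (h0 : 0 < β) (h1 : β < 1) {r : ℝ} (hr : 0 ≤ r) :
    IntegrableOn (fun s : ℝ ↦ (1 - exp (-s * r)) * s ^ (-1 - β)) (Ioi 0) := by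
  rcases hr.eq_or_lt with rfl | hr
  · simp
  have h := (integrableOn_Ioi_comp_mul_left_iff
    (fun s : ℝ ↦ (1 - exp (-s)) * s ^ (-1 - β)) 0 hr).2
      (by simpa using integrableOn_one_sub_exp_mul_rpow h0 h1)
  exact IntegrableOn.congr_fun (h.const_mul (r ^ (1 + β)))
    (fun s hs ↦ (one_sub_exp_mul_rpow_comp_mul hr hs).symm) measurableSet_Ioi

lemma integral_one_sub_exp_mul_mul_rpow (h0 : 0 < β) {r : ℝ} (hr : 0 ≤ r) :
    ∫ s in Ioi (0 : ℝ), (1 - exp (-s * r)) * s ^ (-1 - β) = powMixtureConst β * r ^ β := by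
  rcases hr.eq_or_lt with rfl | hr
  · simp [zero_rpow h0.ne']
  rw [setIntegral_congr_fun measurableSet_Ioi fun s hs ↦ one_sub_exp_mul_rpow_comp_mul hr hs,
    integral_const_mul,
    integral_comp_mul_left_Ioi (fun s : ℝ ↦ (1 - exp (-s)) * s ^ (-1 - β)) 0 hr, mul_zero,
    rpow_add hr, rpow_one, smul_eq_mul, powMixtureConst]
  field_simp

/-- The moment `∫ h ^ β ∂ρ` is a mixture over `s` of the values `1 - ∫ exp (-s * h) ∂ρ`. -/
lemma integral_rpow_eq_integral_one_sub_laplace {Z : Type*} [MeasurableSpace Z] (ρ : Measure Z)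
    [IsProbabilityMeasure ρ] (h0 : 0 < β) (h1 : β < 1) {h : Z → ℝ} (hm : Measurable h)
    (hnn : ∀ z, 0 ≤ h z) (hi : Integrable (fun z ↦ h z ^ β) ρ) :
    IntegrableOn (fun s : ℝ ↦ s ^ (-1 - β) * (1 - ∫ z, exp (-s * h z) ∂ρ)) (Ioi 0) ∧
      ∫ s in Ioi (0 : ℝ), s ^ (-1 - β) * (1 - ∫ z, exp (-s * h z) ∂ρ) =
        powMixtureConst β * ∫ z, h z ^ β ∂ρ := by
  have hF : Integrable (fun q : ℝ × Z ↦ (1 - exp (-q.1 * h q.2)) * q.1 ^ (-1 - β))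
      ((volume.restrict (Ioi 0)).prod ρ) := by
    -- Integrating in `s` first turns the nonnegative integrand into a multiple of `h z ^ β`, so the
    -- moment hypothesis gives joint integrability.
    rw [integrable_prod_iff' (by fun_prop)]
    refine ⟨.of_forall fun z ↦ integrableOn_one_sub_exp_mul_mul_rpow h0 h1 (hnn z), ?_⟩
    refine (hi.const_mul (powMixtureConst β)).congr (.of_forall fun z ↦ ?_)
    dsimp only
    rw [← integral_one_sub_exp_mul_mul_rpow h0 (hnn z)]
    refine setIntegral_congr_fun measurableSet_Ioi fun s hs ↦ ?_
    have hs : 0 < s := hs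
    have := mul_nonneg hs.le (hnn z)
    exact (norm_of_nonneg (mul_nonneg (by simpa using this) (by positivity))).symm
  have hin : ∀ s ∈ Ioi (0 : ℝ), ∫ z, (1 - exp (-s * h z)) * s ^ (-1 - β) ∂ρ =
      s ^ (-1 - β) * (1 - ∫ z, exp (-s * h z) ∂ρ) := fun s hs ↦ by
    have : Integrable (fun z ↦ exp (-s * h z)) ρ :=
      .of_bound (by fun_prop) 1 (.of_forall fun z ↦ by
        have := mul_nonneg (le_of_lt hs) (hnn z)
        simpa using this)
    rw [integral_mul_const, integral_sub (by fun_prop) this]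
    simp [mul_comm]
  refine ⟨IntegrableOn.congr_fun hF.integral_prod_left hin measurableSet_Ioi, ?_⟩
  rw [← setIntegral_congr_fun measurableSet_Ioi hin,
    integral_integral_swap (f := fun s z ↦ (1 - exp (-s * h z)) * s ^ (-1 - β)) hF,
    ← integral_const_mul]
  congr 1 with z
  exact integral_one_sub_exp_mul_mul_rpow h0 (hnn z)

end PowerMixture

/-! ### Energy of two laws, and transfer to random vectors -/

section Energy

/-- Bounding by the maximum of the norms treats `α < 1` and `α ≥ 1` alike. -/
lemma norm_sub_rpow_le {E : Type*} [SeminormedAddCommGroup E] {α : ℝ} (hα : 0 ≤ α) (x y : E) :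
    ‖x - y‖ ^ α ≤ 2 ^ α * (‖x‖ ^ α + ‖y‖ ^ α) := by
  have h : ‖x - y‖ ≤ 2 * max ‖x‖ ‖y‖ := by
    linarith [norm_sub_le x y, le_max_left ‖x‖ ‖y‖, le_max_right ‖x‖ ‖y‖]
  calc ‖x - y‖ ^ α ≤ (2 * max ‖x‖ ‖y‖) ^ α := by gcongr
    _ = 2 ^ α * (max ‖x‖ ‖y‖) ^ α := Real.mul_rpow (by norm_num) (by positivity)
    _ ≤ 2 ^ α * (‖x‖ ^ α + ‖y‖ ^ α) := by
      gcongr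
      rcases max_choice ‖x‖ ‖y‖ with h | h <;> rw [h]
      · exact le_add_of_nonneg_right (by positivity)
      · exact le_add_of_nonneg_left (by positivity)

lemma MeasureTheory.Integrable.norm_sub_rpow {E Ω : Type*} [NormedAddCommGroup E]
    {mΩ : MeasurableSpace Ω} {P : Measure Ω} {X Y : Ω → E} {α : ℝ} (hα : 0 ≤ α)
    (hXm : AEStronglyMeasurable X P) (hYm : AEStronglyMeasurable Y P)
    (hX : Integrable (fun ω ↦ ‖X ω‖ ^ α) P) (hY : Integrable (fun ω ↦ ‖Y ω‖ ^ α) P) :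
    Integrable (fun ω ↦ ‖X ω - Y ω‖ ^ α) P := by
  refine ((hX.add hY).const_mul (2 ^ α)).mono'
    ((hXm.sub hYm).norm.aemeasurable.pow_const α).aestronglyMeasurable (.of_forall fun ω ↦ ?_)
  rw [Real.norm_of_nonneg (by positivity)]
  exact norm_sub_rpow_le hα _ _

variable {E : Type*} [NormedAddCommGroup E] [InnerProductSpace ℝ E] [FiniteDimensional ℝ E]
  [MeasurableSpace E] [BorelSpace E]

/-- The energy distance of two laws, with exponent `α`. -/
noncomputable def lawEnergy (α : ℝ) (μ ν : Measure E) : ℝ :=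
  2 * (∫ z, ‖z.1 - z.2‖ ^ α ∂(μ.prod ν)) - (∫ z, ‖z.1 - z.2‖ ^ α ∂(μ.prod μ)) -
    ∫ z, ‖z.1 - z.2‖ ^ α ∂(ν.prod ν)

section LawEnergy

variable {μ ν : Measure E} [IsProbabilityMeasure μ] [IsProbabilityMeasure ν] {α : ℝ}

lemma integrable_norm_sub_rpow_prod (hα : 0 ≤ α) (hμ : Integrable (fun x ↦ ‖x‖ ^ α) μ)
    (hν : Integrable (fun x ↦ ‖x‖ ^ α) ν) :
    Integrable (fun z : E × E ↦ ‖z.1 - z.2‖ ^ α) (μ.prod ν) :=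
  Integrable.norm_sub_rpow hα (by fun_prop) (by fun_prop) (hμ.comp_fst ν) (hν.comp_snd μ)

lemma lawEnergy_eq_integral_gaussianDiscrepancy (hα0 : 0 < α) (hα2 : α < 2)
    (hμ : Integrable (fun x ↦ ‖x‖ ^ α) μ) (hν : Integrable (fun x ↦ ‖x‖ ^ α) ν) :
    IntegrableOn (fun s : ℝ ↦ s ^ (-1 - α / 2) * gaussianDiscrepancy s μ ν) (Set.Ioi 0) ∧
      ∫ s in Set.Ioi (0 : ℝ), s ^ (-1 - α / 2) * gaussianDiscrepancy s μ ν =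
        powMixtureConst (α / 2) * lawEnergy α μ ν := by
  have hpow (z : E × E) : (‖z.1 - z.2‖ ^ 2) ^ (α / 2) = ‖z.1 - z.2‖ ^ α := by
    rw [← Real.rpow_natCast, ← Real.rpow_mul (norm_nonneg _)]
    congr 1
    push_cast
    ring
  have key (μ ν : Measure E) [IsProbabilityMeasure μ] [IsProbabilityMeasure ν]
      (hμ : Integrable (fun x ↦ ‖x‖ ^ α) μ) (hν : Integrable (fun x ↦ ‖x‖ ^ α) ν) :=
    integral_rpow_eq_integral_one_sub_laplace (μ.prod ν) (β := α / 2) (by linarith) (by linarith)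
      (h := fun z ↦ ‖z.1 - z.2‖ ^ 2) (by fun_prop) (fun z ↦ by positivity)
      (by simpa only [hpow] using integrable_norm_sub_rpow_prod hα0.le hμ hν)
  simp only [hpow] at key
  obtain ⟨h1, e1⟩ := key μ μ hμ hμ
  obtain ⟨h2, e2⟩ := key ν ν hν hν
  obtain ⟨h3, e3⟩ := key μ ν hμ hν
  -- The constants `1` cancel since `2 - 1 - 1 = 0`.
  have e : (fun s : ℝ ↦ s ^ (-1 - α / 2) * gaussianDiscrepancy s μ ν) = fun s ↦
      2 * (s ^ (-1 - α / 2) * (1 - ∫ z, Real.exp (-s * ‖z.1 - z.2‖ ^ 2) ∂(μ.prod ν))) -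
        s ^ (-1 - α / 2) * (1 - ∫ z, Real.exp (-s * ‖z.1 - z.2‖ ^ 2) ∂(μ.prod μ)) -
        s ^ (-1 - α / 2) * (1 - ∫ z, Real.exp (-s * ‖z.1 - z.2‖ ^ 2) ∂(ν.prod ν)) := by
    ext s
    rw [gaussianDiscrepancy]
    ring
  rw [e]
  have h3' := h3.const_mul 2
  refine ⟨(h3'.sub h1).sub h2, ?_⟩
  rw [integral_sub (by exact h3'.sub h1) h2, integral_sub h3' h1, integral_const_mul, e1, e2, e3,
    lawEnergy]
  ring

lemma lawEnergy_nonneg_of_lt_two (hα0 : 0 < α) (hα2 : α < 2)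
    (hμ : Integrable (fun x ↦ ‖x‖ ^ α) μ) (hν : Integrable (fun x ↦ ‖x‖ ^ α) ν) :
    0 ≤ lawEnergy α μ ν := by
  refine nonneg_of_mul_nonneg_right ?_
    (powMixtureConst_pos (β := α / 2) (by linarith) (by linarith))
  rw [← (lawEnergy_eq_integral_gaussianDiscrepancy hα0 hα2 hμ hν).2]
  exact setIntegral_nonneg measurableSet_Ioi fun s hs ↦
    mul_nonneg (Real.rpow_nonneg (le_of_lt hs) _) (gaussianDiscrepancy_nonneg μ ν hs)

lemma lawEnergy_eq_zero_iff_of_lt_two (hα0 : 0 < α) (hα2 : α < 2)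
    (hμ : Integrable (fun x ↦ ‖x‖ ^ α) μ) (hν : Integrable (fun x ↦ ‖x‖ ^ α) ν) :
    lawEnergy α μ ν = 0 ↔ μ = ν := by
  refine ⟨fun h ↦ ?_, fun h ↦ ?_⟩
  · obtain ⟨hi, he⟩ := lawEnergy_eq_integral_gaussianDiscrepancy hα0 hα2 hμ hν
    rw [h, mul_zero, setIntegral_eq_zero_iff_of_nonneg_ae
      (ae_restrict_of_forall_mem measurableSet_Ioi fun s hs ↦
        mul_nonneg (Real.rpow_nonneg (le_of_lt hs) _) (gaussianDiscrepancy_nonneg μ ν hs)) hi] at he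
    -- The discrepancy vanishes for almost every `s > 0`, hence for at least one, and a single scale
    -- already separates laws.
    have : (ae (volume.restrict (Set.Ioi (0 : ℝ)))).NeBot := by
      rw [ae_neBot, Ne, Measure.restrict_eq_zero]
      simp
    obtain ⟨s, hs0, hs⟩ := (he.and (ae_restrict_mem measurableSet_Ioi)).exists
    refine eq_of_gaussianDiscrepancy_eq_zero hs ?_
    exact (mul_eq_zero.1 hs0).resolve_left (Real.rpow_pos_of_pos hs _).ne'
  · subst h
    rw [lawEnergy]
    ring

lemma integrable_id_of_integrable_norm_rpow_two (hμ : Integrable (fun x ↦ ‖x‖ ^ (2 : ℝ)) μ) :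
    Integrable (fun x ↦ x) μ := by
  have h : MemLp (fun x : E ↦ x) 2 μ := by
    rw [memLp_two_iff_integrable_sq_norm (by fun_prop)]
    simpa using hμ
  exact h.integrable one_le_two

/-- Under a product measure the cross term of the expanded square is the inner product of the means;
the second moments cancel. -/
lemma lawEnergy_two (hμ : Integrable (fun x ↦ ‖x‖ ^ (2 : ℝ)) μ)
    (hν : Integrable (fun x ↦ ‖x‖ ^ (2 : ℝ)) ν) :
    lawEnergy 2 μ ν = 2 * ‖(∫ x, x ∂μ) - ∫ x, x ∂ν‖ ^ 2 := by
  have key (μ ν : Measure E) [IsProbabilityMeasure μ] [IsProbabilityMeasure ν]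
      (hμ : Integrable (fun x ↦ ‖x‖ ^ (2 : ℝ)) μ) (hν : Integrable (fun x ↦ ‖x‖ ^ (2 : ℝ)) ν) :
      ∫ z, ‖z.1 - z.2‖ ^ (2 : ℝ) ∂(μ.prod ν) = (∫ x, ‖x‖ ^ (2 : ℝ) ∂μ) + (∫ x, ‖x‖ ^ (2 : ℝ) ∂ν) -
        2 * inner ℝ (∫ x, x ∂μ) (∫ x, x ∂ν) := by
    have iμ := integrable_id_of_integrable_norm_rpow_two hμ
    have iν := integrable_id_of_integrable_norm_rpow_two hν
    have hin (x : E) : ∫ y, ‖x - y‖ ^ (2 : ℝ) ∂ν =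
        ‖x‖ ^ (2 : ℝ) + (∫ y, ‖y‖ ^ (2 : ℝ) ∂ν) - 2 * inner ℝ x (∫ y, y ∂ν) := by
      have e : (fun y : E ↦ ‖x - y‖ ^ (2 : ℝ)) =
          fun y ↦ ‖x‖ ^ (2 : ℝ) + ‖y‖ ^ (2 : ℝ) - 2 * inner ℝ x y := by
        ext y
        simp only [Real.rpow_two]
        rw [norm_sub_sq_real]
        ring
      have hc : Integrable (fun y : E ↦ 2 * inner ℝ x y) ν := (iν.const_inner x).const_mul 2
      rw [e, integral_sub (by exact (integrable_const _).add hν) hc,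
        integral_add (integrable_const _) hν, integral_const_mul, integral_inner iν]
      simp
    have hc : Integrable (fun x : E ↦ 2 * inner ℝ x (∫ y, y ∂ν)) μ :=
      (iμ.inner_const _).const_mul 2
    rw [integral_prod _ (integrable_norm_sub_rpow_prod zero_le_two hμ hν)]
    simp only [hin]
    rw [integral_sub (by exact hμ.add (integrable_const _)) hc,
      integral_add hμ (integrable_const _), integral_const_mul]
    simp_rw [real_inner_comm (∫ y, y ∂ν)]
    rw [integral_inner iμ]
    simp
  rw [lawEnergy, key μ ν hμ hν, key μ μ hμ hμ, key ν ν hν hν, norm_sub_sq_real,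
    real_inner_self_eq_norm_sq, real_inner_self_eq_norm_sq]
  ring

end LawEnergy

lemma ProbabilityTheory.IndepFun.integral_norm_sub_rpow {Ω : Type*} {mΩ : MeasurableSpace Ω}
    {P : Measure Ω} [IsFiniteMeasure P] {X Y : Ω → E} (h : IndepFun X Y P)
    (hX : AEMeasurable X P) (hY : AEMeasurable Y P) (α : ℝ) :
    ∫ ω, ‖X ω - Y ω‖ ^ α ∂P = ∫ z, ‖z.1 - z.2‖ ^ α ∂((P.map X).prod (P.map Y)) := by
  rw [← (indepFun_iff_map_prod_eq_prod_map_map hX hY).1 h, integral_map (hX.prodMk hY)]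
  exact Measurable.aestronglyMeasurable (by fun_prop)

end Energy

theorem theorem1 {Ω : Type*} [MeasurableSpace Ω] (P : Measure Ω) [IsProbabilityMeasure P]
    (p : ℕ) (X X' Y Y' : Ω → EuclideanSpace ℝ (Fin p))
    (hX : IdentDistrib X X' P P) (hXX' : IndepFun X X' P)
    (hY : IdentDistrib Y Y' P P) (hYY' : IndepFun Y Y' P)
    (hXY : IndepFun X Y P)
    (α : ℝ) (hα0 : 0 < α) (hα2 : α ≤ 2)
    (hXα : Integrable (fun ω => ‖X ω‖ ^ α) P)
    (hYα : Integrable (fun ω => ‖Y ω‖ ^ α) P) :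
    (Integrable (fun ω => ‖X ω - Y ω‖ ^ α) P ∧
      Integrable (fun ω => ‖X ω - X' ω‖ ^ α) P ∧
      Integrable (fun ω => ‖Y ω - Y' ω‖ ^ α) P) ∧
    0 ≤ energyDistance P α X X' Y Y' ∧
    (α < 2 → (energyDistance P α X X' Y Y' = 0 ↔ IdentDistrib X Y P P)) ∧
    (α = 2 → Integrable X P ∧ Integrable Y P ∧
      (energyDistance P α X X' Y Y' = 0 ↔ ∫ ω, X ω ∂P = ∫ ω, Y ω ∂P)) := by
  have mX := hX.aemeasurable_fst
  have mX' := hX.aemeasurable_snd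
  have mY := hY.aemeasurable_fst
  have mY' := hY.aemeasurable_snd
  have : IsProbabilityMeasure (P.map X) := Measure.isProbabilityMeasure_map mX
  have : IsProbabilityMeasure (P.map Y) := Measure.isProbabilityMeasure_map mY
  have hu : Measurable fun x : EuclideanSpace ℝ (Fin p) ↦ ‖x‖ ^ α := by fun_prop
  have hX'α : Integrable (fun ω => ‖X' ω‖ ^ α) P := (hX.comp hu).integrable_iff.1 hXα
  have hY'α : Integrable (fun ω => ‖Y' ω‖ ^ α) P := (hY.comp hu).integrable_iff.1 hYα
  have hμ : Integrable (fun x ↦ ‖x‖ ^ α) (P.map X) :=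
    (integrable_map_measure hu.aestronglyMeasurable mX).2 hXα
  have hν : Integrable (fun x ↦ ‖x‖ ^ α) (P.map Y) :=
    (integrable_map_measure hu.aestronglyMeasurable mY).2 hYα
  -- Each expectation involves one independent pair, so it depends only on the two marginal laws.
  have hE : energyDistance P α X X' Y Y' = lawEnergy α (P.map X) (P.map Y) := by
    rw [energyDistance, lawEnergy, hXY.integral_norm_sub_rpow mX mY,
      hXX'.integral_norm_sub_rpow mX mX', hYY'.integral_norm_sub_rpow mY mY', ← hX.map_eq,
      ← hY.map_eq]
  rw [hE]
  refine ⟨⟨hXα.norm_sub_rpow hα0.le mX.aestronglyMeasurable mY.aestronglyMeasurable hYα,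
    hXα.norm_sub_rpow hα0.le mX.aestronglyMeasurable mX'.aestronglyMeasurable hX'α,
    hYα.norm_sub_rpow hα0.le mY.aestronglyMeasurable mY'.aestronglyMeasurable hY'α⟩, ?_, ?_, ?_⟩
  · rcases hα2.lt_or_eq with h | rfl
    · exact lawEnergy_nonneg_of_lt_two hα0 h hμ hν
    · rw [lawEnergy_two hμ hν]
      positivity
  · intro h
    rw [lawEnergy_eq_zero_iff_of_lt_two hα0 h hμ hν]
    exact ⟨fun h ↦ ⟨mX, mY, h⟩, fun h ↦ h.map_eq⟩
  · rintro rfl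
    have iμ := integrable_id_of_integrable_norm_rpow_two hμ
    have iν := integrable_id_of_integrable_norm_rpow_two hν
    refine ⟨(integrable_map_measure (by fun_prop) mX).1 iμ,
      (integrable_map_measure (by fun_prop) mY).1 iν, ?_⟩
    rw [lawEnergy_two hμ hν, integral_map mX (by fun_prop), integral_map mY (by fun_prop)]
    simp [sub_eq_zero]
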